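/- Let $n\ge 1$, let $V_{n-1}=\{x\in\mathbb{R}^n : x_1+x_2+\cdots+x_n=0\}$, and let $\underline{a}=(a_1,\ldots,a_n)$ be a vector of nonnegative real numbers. The $\underline{a}$-generalized Linial arrangement is the set of the hyperplanes $$x_i-x_j=a_i\qquad (1\le i<j\le n)$$ in $V_{n-1}$; its regions are the connected components of the complement in $V_{n-1}$ of the union of these hyperplanes. Let $H_{2n-1}$ denote the median Genocchi numbers (Genocchi numbers of the second kind) $H_1,H_3,H_5,H_7,H_9,\ldots=1,2,8,56,608,\ldots$; that is, $H_{2n-1}=g(2n,1)$, where the Seidel triangle $g(r,k)$ ($r\ge 1$, $1\le k\le\lceil r/2\rceil$; $g(r,k)=0$ for $k>\lceil r/2\rceil$) is defined by $g(1,1)=1$, $g(2i,k)=\sum_{l=k}^{i}g(2i-1,l)$ for $i\geq 1$, $1\le k\le i$, and $g(2i+1,k)=\sum_{l=1}^{k}g(2i,l)$ for $i\geq 1$, $1\le k\le i+1$. Then the number of regions of the $\underline{a}$-generalized Linial arrangement in $V_{n-1}$ is at most $H_{2n-1}$ (in particular it is finite). -/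

import Mathlib

/-- The hyperplane `x_1 + ⋯ + x_n = 0` of `ℝⁿ` (written `V_{n-1}`), as a linear subspace. -/
def sumZeroSpace (n : ℕ) : Submodule ℝ (EuclideanSpace ℝ (Fin n)) where
  carrier := {x | ∑ i, x i = 0}
  zero_mem' := by simp
  add_mem' := by
    intro x y hx hy
    simp only [Set.mem_ofPred_eq] at hx hy ⊢
    simp [Finset.sum_add_distrib, hx, hy]
  smul_mem' := by
    intro c x hx
    simp only [Set.mem_ofPred_eq] at hx ⊢
    simp [← Finset.mul_sum, hx]

/-- The `a`-generalized Linial arrangement: the set of all the hyperplanes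
`{x | x_i - x_j = a_i}`, `i < j`, of `V_{n-1}`. -/
def generalizedLinialArrangement {n : ℕ} (a : Fin n → ℝ) : Set (Set (sumZeroSpace n)) :=
  {H | ∃ i j : Fin n, i < j ∧ H = {x | x.1 i - x.1 j = a i}}

/-- The regions of an arrangement `𝒜` of hyperplanes of `E`: the connected components of the
complement in `E` of the union of the hyperplanes. -/
def arrangementRegions {E : Type*} [TopologicalSpace E] (𝒜 : Set (Set E)) : Set (Set E) :=
  {R | ∃ x ∈ (⋃₀ 𝒜)ᶜ, R = connectedComponentIn (⋃₀ 𝒜)ᶜ x}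

/-- The Seidel triangle of the Genocchi numbers; `seidelTriangle r k` is the `k`-th entry of the
`r`-th row. Rows and entries are numbered from `1`, the `r`-th row has `⌈r/2⌉` entries, and the
value is `0` outside of the triangle. The first row is `1`; an even row consists of the
sums of the final segments of the row above it, an odd row of the sums of the initial segments:
`1 / 1 / 1 1 / 2 1 / 2 3 3 / 8 6 3 / 8 14 17 17 / 56 48 34 17 / …` -/
def seidelTriangle : ℕ → ℕ → ℕ
  | 0, _ => 0
  | 1, k => if k = 1 then 1 else 0
  | m + 2, k =>
    if 1 ≤ k ∧ k ≤ (m + 3) / 2 then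
      if Even m then ∑ l ∈ Finset.Icc k ((m + 2) / 2), seidelTriangle (m + 1) l
      else ∑ l ∈ Finset.Icc 1 k, seidelTriangle (m + 1) l
    else 0

/-- `medianGenocchi n`, for `n ≥ 1`, is the median Genocchi number `H_{2n-1}` (the Genocchi number
of the second kind), that is, the first entry of row `2n` of the Seidel triangle:
`H_1, H_3, H_5, H_7, H_9, … = 1, 2, 8, 56, 608, …` -/
def medianGenocchi (n : ℕ) : ℕ := seidelTriangle (2 * n) 1

theorem seidelTriangle_eq_zero_of_lt {r k : ℕ} (h : (r + 1) / 2 < k) : seidelTriangle r k = 0 := by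
  match r with
  | 0 => simp [seidelTriangle]
  | 1 =>
    have : k ≠ 1 := by omega
    simp [seidelTriangle, this]
  | m + 2 =>
    rw [seidelTriangle, if_neg (by omega)]

theorem seidelTriangle_zero_right (r : ℕ) : seidelTriangle r 0 = 0 := by
  match r with
  | 0 => simp [seidelTriangle]
  | 1 => simp [seidelTriangle]
  | m + 2 => simp [seidelTriangle]

theorem seidelTriangle_even_row (i k : ℕ) (hk : 1 ≤ k) (hki : k ≤ i + 1) :
    seidelTriangle (2 * i + 2) k
      = seidelTriangle (2 * i + 2) (k + 1) + seidelTriangle (2 * i + 1) k := by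
  have hs : ∀ k, 1 ≤ k → seidelTriangle (2 * i + 2) k =
      ∑ l ∈ Finset.Icc k (i + 1), seidelTriangle (2 * i + 1) l := by
    intro k hk
    rw [seidelTriangle]
    split_ifs with h1 h2
    · congr 2; omega
    · exact absurd (even_two_mul i) h2
    · rw [Finset.Icc_eq_empty (by omega), Finset.sum_empty]
  rw [hs k hk, hs (k + 1) (by omega), ← Finset.add_sum_Ioc_eq_sum_Icc hki, add_comm,
    show Finset.Ioc k (i + 1) = Finset.Icc (k + 1) (i + 1) by ext; simp]

theorem seidelTriangle_odd_row (i k : ℕ) (hki : k ≤ i + 1) :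
    seidelTriangle (2 * i + 3) (k + 1)
      = seidelTriangle (2 * i + 3) k + seidelTriangle (2 * i + 2) (k + 1) := by
  have hs : ∀ k, k ≤ i + 2 → seidelTriangle (2 * i + 3) k =
      ∑ l ∈ Finset.Icc 1 k, seidelTriangle (2 * i + 2) l := by
    intro k hk
    rw [show 2 * i + 3 = (2 * i + 1) + 2 by ring, seidelTriangle]
    split_ifs with h1 h2
    · exact absurd (odd_two_mul_add_one i) (Nat.not_odd_iff_even.2 h2)
    · rfl
    · rw [Finset.Icc_eq_empty (by omega), Finset.sum_empty]
  rw [hs _ (by omega), hs _ (by omega), Finset.sum_Icc_succ_top (by omega)]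

/-- The moments of the functional `genocchiFunctional`: up to sign the last entries of the odd rows
of the Seidel triangle. -/
def genocchiMoment (m : ℕ) : ℤ :=
  if m = 0 then -1
  else if Even m then 0
  else (-1) ^ (m / 2) * seidelTriangle m ((m + 1) / 2)

open Polynomial in
/-- The linear functional on `ℤ[X]` whose values on `X ^ a * (X + 1) ^ b` are, up to sign, the
entries of the Seidel triangle. -/
noncomputable def genocchiFunctional : ℤ[X] →ₗ[ℤ] ℤ :=
  Polynomial.lsum fun m => genocchiMoment m • LinearMap.id

namespace genocchiFunctional

open Polynomial

local notation "Λ" => genocchiFunctional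

theorem apply_X_pow (m : ℕ) : Λ (X ^ m) = genocchiMoment m := by
  rw [← monomial_one_right_eq_X_pow, genocchiFunctional, Polynomial.lsum_apply,
    Polynomial.sum_monomial_index] <;> simp

theorem apply_succ (a b : ℕ) :
    Λ (X ^ a * (X + 1) ^ (b + 1)) = Λ (X ^ (a + 1) * (X + 1) ^ b) + Λ (X ^ a * (X + 1) ^ b) := by
  rw [← map_add]; congr 1; ring

theorem apply_even_row_of_odd_row (i : ℕ)
    (h : ∀ j ≤ i + 1, Λ (X ^ (2 * i + 1 - j) * (X + 1) ^ j)
      = (-1) ^ i * seidelTriangle (2 * i + 1) (i + 1 - j)) (j : ℕ) (hj : j ≤ i + 1) :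
    Λ (X ^ (2 * i + 2 - j) * (X + 1) ^ j)
      = (-1) ^ i * seidelTriangle (2 * i + 2) (i + 2 - j) := by
  induction j with
  | zero =>
    rw [pow_zero, mul_one, apply_X_pow, genocchiMoment, if_neg (by omega),
      if_pos (by simp [parity_simps]), seidelTriangle_eq_zero_of_lt (by omega)]
    simp
  | succ j ih =>
    have h1 := ih (by omega)
    have h2 := h j (by omega)
    rw [show 2 * i + 2 - (j + 1) = 2 * i + 1 - j by omega, apply_succ, h2,
      show 2 * i + 1 - j + 1 = 2 * i + 2 - j by omega, h1,
      show i + 2 - (j + 1) = i + 1 - j by omega,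
      seidelTriangle_even_row i (i + 1 - j) (by omega) (by omega),
      show i + 1 - j + 1 = i + 2 - j by omega]
    push_cast; ring

theorem apply_odd_row (i : ℕ) : ∀ j ≤ i + 1, Λ (X ^ (2 * i + 1 - j) * (X + 1) ^ j)
      = (-1) ^ i * seidelTriangle (2 * i + 1) (i + 1 - j) := by
  induction i with
  | zero =>
    intro j hj
    have h0 : Λ (X ^ 0) = -1 := by rw [apply_X_pow]; simp [genocchiMoment]
    have h1 : Λ (X ^ 1) = 1 := by rw [apply_X_pow]; simp [genocchiMoment, seidelTriangle]
    interval_cases j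
    · simpa [seidelTriangle] using h1
    · simp only [pow_zero, pow_one] at h0 h1
      simp [seidelTriangle, h0, h1]
  | succ i ih =>
    intro j hj
    induction j with
    | zero =>
      rw [pow_zero, mul_one, apply_X_pow, genocchiMoment, if_neg (by omega), if_neg]
      · congr 2 <;> congr 1 <;> omega
      · simp [parity_simps]
    | succ j ihj =>
      have h1 := ihj (by omega)
      have h2 := apply_even_row_of_odd_row i ih j (by omega)
      have h3 := seidelTriangle_odd_row i (i + 1 - j) (by omega)
      rw [show i + 1 - j + 1 = i + 2 - j by omega] at h3
      rw [show 2 * (i + 1) + 1 - (j + 1) = 2 * i + 2 - j by omega, apply_succ, h2,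
        show 2 * i + 2 - j + 1 = 2 * (i + 1) + 1 - j by omega, h1,
        show i + 1 + 1 - j = i + 2 - j by omega, show 2 * (i + 1) + 1 = 2 * i + 3 by ring, h3,
        show i + 1 + 1 - (j + 1) = i + 1 - j by omega]
      push_cast; ring

theorem apply_median (i : ℕ) :
    Λ ((X * (X + 1)) ^ (i + 1)) = (-1) ^ i * medianGenocchi (i + 1) := by
  have h := apply_even_row_of_odd_row i (apply_odd_row i) (i + 1) le_rfl
  rw [show 2 * i + 2 - (i + 1) = i + 1 by omega, show i + 2 - (i + 1) = 1 by omega] at h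
  rw [mul_pow, h, medianGenocchi, show 2 * (i + 1) = 2 * i + 2 by ring]

theorem apply_X_add_one_mul (j : ℕ) : Λ ((X + 1) * (X * (X + 1)) ^ j) = 0 := by
  have h := apply_odd_row j (j + 1) le_rfl
  rw [show 2 * j + 1 - (j + 1) = j by omega, Nat.sub_self, seidelTriangle_zero_right] at h
  rw [show (X + 1 : ℤ[X]) * (X * (X + 1)) ^ j = X ^ j * (X + 1) ^ (j + 1) by
    rw [mul_pow]; ring, h]
  simp

theorem map_int_mul (c : ℤ) (p : ℤ[X]) : Λ ((c : ℤ[X]) * p) = c * Λ p := by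
  rw [← zsmul_eq_mul, map_zsmul, smul_eq_mul]

/-- The product of the `X (X + 1) - i (i + 1)`, `1 ≤ i ≤ k`. -/
noncomputable def prodA (k : ℕ) : ℤ[X] :=
  ∏ i ∈ Finset.range k, (X * (X + 1) - (((i + 1) * (i + 2) : ℤ) : ℤ[X]))

/-- The product of the `X ^ 2 - i ^ 2`, `1 ≤ i ≤ k`. -/
noncomputable def prodB (k : ℕ) : ℤ[X] :=
  ∏ i ∈ Finset.range k, (X ^ 2 - ((((i + 1) ^ 2 : ℤ)) : ℤ[X]))

theorem prodA_succ (k : ℕ) :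
    prodA (k + 1) = prodA k * (X * (X + 1) - (((k + 1) * (k + 2) : ℤ) : ℤ[X])) :=
  Finset.prod_range_succ _ _

theorem prodB_succ (k : ℕ) :
    prodB (k + 1) = prodB k * (X ^ 2 - (((k + 1) ^ 2 : ℤ) : ℤ[X])) :=
  Finset.prod_range_succ _ _

theorem X_add_one_mul_prodA (k : ℕ) : (X + 1) * prodA k = prodB k * (X + (k : ℤ[X]) + 1) := by
  induction k with
  | zero => simp [prodA, prodB]
  | succ k ih =>
    rw [prodA_succ, prodB_succ, ← mul_assoc, ih]
    push_cast; ring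

theorem apply_X_add_one_mul_prodA (k : ℕ) : ∀ j,
    Λ ((X + 1) * (X * (X + 1)) ^ j * prodA k) = 0 := by
  induction k with
  | zero => intro j; simpa [prodA] using apply_X_add_one_mul j
  | succ k ih =>
    intro j
    rw [prodA_succ, show (X + 1 : ℤ[X]) * (X * (X + 1)) ^ j *
        (prodA k * (X * (X + 1) - (((k + 1) * (k + 2) : ℤ) : ℤ[X])))
      = (X + 1) * (X * (X + 1)) ^ (j + 1) * prodA k
        - (((k + 1) * (k + 2) : ℤ) : ℤ[X]) * ((X + 1) * (X * (X + 1)) ^ j * prodA k) by ring,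
      map_sub, map_int_mul, ih, ih, mul_zero, sub_zero]

theorem apply_X_sq_mul_prodB (k : ℕ) : ∀ j, Λ (X ^ (2 * j + 2) * prodB k) = 0 := by
  induction k with
  | zero =>
    intro j
    simp [prodB, apply_X_pow, genocchiMoment, parity_simps]
  | succ k ih =>
    intro j
    rw [prodB_succ, show (X : ℤ[X]) ^ (2 * j + 2) *
        (prodB k * (X ^ 2 - (((k + 1) ^ 2 : ℤ) : ℤ[X])))
      = X ^ (2 * (j + 1) + 2) * prodB k
        - (((k + 1) ^ 2 : ℤ) : ℤ[X]) * (X ^ (2 * j + 2) * prodB k) by ring,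
      map_sub, map_int_mul, ih, ih, mul_zero, sub_zero]

theorem apply_prodB (k : ℕ) : Λ (prodB k) = (-1) ^ (k + 1) * (k.factorial : ℤ) ^ 2 := by
  induction k with
  | zero =>
    have h := apply_X_pow 0
    simpa [prodB, genocchiMoment] using h
  | succ k ih =>
    have h := apply_X_sq_mul_prodB k 0
    rw [prodB_succ, show prodB k * (X ^ 2 - (((k + 1) ^ 2 : ℤ) : ℤ[X]))
      = X ^ (2 * 0 + 2) * prodB k - (((k + 1) ^ 2 : ℤ) : ℤ[X]) * prodB k by ring,
      map_sub, map_int_mul, h, ih, Nat.factorial_succ]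
    push_cast; ring

theorem apply_prodA (k : ℕ) :
    Λ (X * (X + 1) * prodA k) = (-1) ^ k * ((k + 1).factorial : ℤ) ^ 2 := by
  have h1 := apply_X_add_one_mul_prodA k 0
  have h2 := apply_X_sq_mul_prodB k 0
  rw [pow_zero, mul_one, X_add_one_mul_prodA, show prodB k * (X + (k : ℤ[X]) + 1)
    = X * prodB k + ((k + 1 : ℤ) : ℤ[X]) * prodB k by push_cast; ring, map_add, map_int_mul,
    apply_prodB] at h1
  rw [mul_assoc, X_add_one_mul_prodA, show X * (prodB k * (X + (k : ℤ[X]) + 1))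
    = X ^ (2 * 0 + 2) * prodB k + ((k + 1 : ℤ) : ℤ[X]) * (X * prodB k) by push_cast; ring,
    map_add, map_int_mul, h2, eq_neg_of_add_eq_zero_left h1, Nat.factorial_succ]
  push_cast; ring

end genocchiFunctional

/-- Values of the Gandhi-type polynomials of the median Genocchi numbers. -/
def gandhiValue : ℕ → ℕ → ℤ
  | 0, _ => 1
  | m + 1, k => (k + 1) * ((k + 1) * gandhiValue m (k + 1) - k * gandhiValue m k)

namespace genocchiFunctional

open Polynomial

local notation "Λ" => genocchiFunctional

theorem apply_pow_mul_prodA (m : ℕ) : ∀ k, Λ ((X * (X + 1)) ^ (m + 1) * prodA k)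
    = (-1) ^ (m + k) * ((k + 1).factorial : ℤ) ^ 2 * gandhiValue m (k + 1) := by
  induction m with
  | zero => intro k; simp [apply_prodA, gandhiValue]
  | succ m ih =>
    intro k
    rw [show (X * (X + 1) : ℤ[X]) ^ (m + 1 + 1) * prodA k
      = (X * (X + 1)) ^ (m + 1) *
          (prodA k * (X * (X + 1) - (((k + 1) * (k + 2) : ℤ) : ℤ[X])))
        + (((k + 1) * (k + 2) : ℤ) : ℤ[X]) * ((X * (X + 1)) ^ (m + 1) * prodA k) by ring,
      ← prodA_succ, map_add, map_int_mul, ih, ih, gandhiValue, Nat.factorial_succ (k + 1)]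
    push_cast; ring

end genocchiFunctional

theorem gandhiValue_one (m : ℕ) : gandhiValue m 1 = medianGenocchi (m + 1) := by
  have h1 := genocchiFunctional.apply_pow_mul_prodA m 0
  have h2 := genocchiFunctional.apply_median m
  simp only [genocchiFunctional.prodA, Finset.range_zero, Finset.prod_empty, mul_one, add_zero,
    zero_add, Nat.factorial_one, Nat.cast_one, one_pow] at h1
  rw [h2] at h1
  exact (mul_left_cancel₀ (pow_ne_zero _ (by norm_num)) h1).symm

/-- The codes of the ways to continue, by `m` further rounds, a linearly ordered list `l` of labels:
each round records the set of the labels below a new threshold, and then inserts a new label. -/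
def thresholdCodes : ℕ → List ℕ → Finset (List (Finset ℕ))
  | 0, _ => {[]}
  | m + 1, l =>
    (((Finset.range (l.length + 1)).image fun i => (l.take i).toFinset) ×ˢ
      ((Finset.range (l.length + 1)).biUnion fun g =>
        thresholdCodes m (l.take g ++ m :: l.drop g))).image fun q => q.1 :: q.2

theorem mem_thresholdCodes_succ {m : ℕ} {l : List ℕ} {p : List (Finset ℕ)} :
    p ∈ thresholdCodes (m + 1) l ↔ ∃ s₁ s₂ s₃ s₄ p', l = s₁ ++ s₂ ∧ l = s₃ ++ s₄ ∧
      p' ∈ thresholdCodes m (s₃ ++ m :: s₄) ∧ p = s₁.toFinset :: p' := by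
  simp only [thresholdCodes, Finset.mem_image, Finset.mem_product, Finset.mem_biUnion,
    Finset.mem_range, Prod.exists]
  constructor
  · rintro ⟨C, p', ⟨⟨i, -, rfl⟩, g, -, hp⟩, rfl⟩
    exact ⟨_, _, _, _, p', (List.take_append_drop i l).symm, (List.take_append_drop g l).symm,
      hp, rfl⟩
  · rintro ⟨s₁, s₂, s₃, s₄, p', h₁, h₂, hp, rfl⟩
    refine ⟨_, p', ⟨⟨s₁.length, ?_, rfl⟩, s₃.length, ?_, ?_⟩, ?_⟩
    · rw [h₁, List.length_append]; omega
    · rw [h₂, List.length_append]; omega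
    · rw [h₂]; simpa using hp
    · rw [h₁]; simp

theorem List.append_cons_eq_append {α : Type*} {l₁ l₂ s₁ s₂ : List α} {a : α}
    (h : l₁ ++ a :: l₂ = s₁ ++ s₂) :
    (∃ t, l₁ = s₁ ++ t ∧ s₂ = t ++ a :: l₂) ∨ (∃ t, s₁ = l₁ ++ a :: t ∧ l₂ = t ++ s₂) := by
  rcases List.append_eq_append_iff.1 h with ⟨t, h₁, h₂⟩ | ⟨t, h₁, h₂⟩
  · cases t with
    | nil => exact Or.inl ⟨[], by simpa using h₁.symm, by simpa using h₂.symm⟩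
    | cons x t =>
      obtain ⟨rfl, rfl⟩ := List.cons_eq_cons.1 (by simpa using h₂)
      exact Or.inr ⟨t, h₁, rfl⟩
  · exact Or.inl ⟨t, h₁, h₂⟩

theorem List.append_cons_cons_eq_append {α : Type*} {l₁ l₂ s₁ s₂ : List α} {a b : α}
    (h : l₁ ++ a :: b :: l₂ = s₁ ++ s₂) :
    (∃ t, l₁ = s₁ ++ t ∧ s₂ = t ++ a :: b :: l₂) ∨ (s₁ = l₁ ++ [a] ∧ s₂ = b :: l₂) ∨
      (∃ t, s₁ = l₁ ++ a :: b :: t ∧ l₂ = t ++ s₂) := by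
  rcases List.append_cons_eq_append h with h | ⟨t, h₁, h₂⟩
  · exact Or.inl h
  · right
    cases t with
    | nil => exact Or.inl ⟨h₁, by simpa using h₂.symm⟩
    | cons x t =>
      obtain ⟨rfl, rfl⟩ := List.cons_eq_cons.1 (by simpa using h₂)
      exact Or.inr ⟨t, h₁, rfl⟩

/-- A list of distinct labels, none of which is less than `m`. -/
def LabelList (m : ℕ) (l : List ℕ) : Prop := l.Nodup ∧ ∀ c ∈ l, m ≤ c

theorem LabelList.perm {m : ℕ} {l l' : List ℕ} (h : LabelList m l) (hl : l.Perm l') :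
    LabelList m l' :=
  ⟨hl.nodup_iff.1 h.1, fun c hc => h.2 c (hl.mem_iff.2 hc)⟩

theorem LabelList.insert {m : ℕ} {l₁ l₂ : List ℕ} (h : LabelList (m + 1) (l₁ ++ l₂)) :
    LabelList m (l₁ ++ m :: l₂) := by
  refine LabelList.perm (l := m :: (l₁ ++ l₂)) ⟨?_, ?_⟩ List.perm_middle.symm
  · refine List.nodup_cons.2 ⟨fun hm => ?_, h.1⟩
    have := h.2 m hm
    omega
  · intro c hc
    rcases List.mem_cons.1 hc with rfl | hc
    · exact le_rfl
    · have := h.2 c hc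
      omega

theorem LabelList.sublist {m : ℕ} {l l' : List ℕ} (h : LabelList m l) (hl : l'.Sublist l) :
    LabelList m l' :=
  ⟨h.1.sublist hl, fun c hc => h.2 c (hl.subset hc)⟩

theorem mem_or_lt_of_mem_thresholdCodes {m : ℕ} {l : List ℕ} {p : List (Finset ℕ)}
    (hp : p ∈ thresholdCodes m l) {C : Finset ℕ} (hC : C ∈ p) {c : ℕ} (hc : c ∈ C) :
    c ∈ l ∨ c < m := by
  induction m generalizing l p with
  | zero =>
    rw [thresholdCodes, Finset.mem_singleton] at hp
    simp [hp] at hC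
  | succ m ih =>
    obtain ⟨s₁, s₂, s₃, s₄, p', h₁, h₂, hp', rfl⟩ := mem_thresholdCodes_succ.1 hp
    rcases List.mem_cons.1 hC with rfl | hC
    · left
      rw [h₁]
      simp only [List.mem_toFinset] at hc
      simp [hc]
    · rcases ih hp' hC with h | h
      · rw [h₂]
        simp only [List.mem_append, List.mem_cons] at h ⊢
        rcases h with h | rfl | h
        · simp [h]
        · simp
        · simp [h]
      · right; omega

/-- The sets of a code are initial segments of the order of the labels. -/
theorem mem_of_sublist_of_mem_thresholdCodes {m : ℕ} {l : List ℕ} {p : List (Finset ℕ)}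
    (hl : LabelList m l) (hp : p ∈ thresholdCodes m l) {a b : ℕ} (hab : [a, b].Sublist l)
    {C : Finset ℕ} (hC : C ∈ p) (hb : b ∈ C) : a ∈ C := by
  induction m generalizing l p with
  | zero =>
    rw [thresholdCodes, Finset.mem_singleton] at hp
    simp [hp] at hC
  | succ m ih =>
    obtain ⟨s₁, s₂, s₃, s₄, p', h₁, h₂, hp', rfl⟩ := mem_thresholdCodes_succ.1 hp
    rcases List.mem_cons.1 hC with rfl | hC
    · simp only [List.mem_toFinset] at hb ⊢
      subst h₁
      by_contra ha
      have hd := (List.nodup_append.1 hl.1).2.2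
      obtain ⟨t₁, t₂, ht, ht₁, ht₂⟩ := List.sublist_append_iff.1 hab
      have hb₂ : b ∈ t₂ := by
        cases t₁ with
        | nil => simp only [List.nil_append] at ht; simp [← ht]
        | cons x t₁ =>
          simp only [List.cons_append, List.cons.injEq] at ht
          exact absurd (ht₁.subset (by simp [ht.1])) ha
      exact hd b hb b (ht₂.subset hb₂) rfl
    · subst h₂
      exact ih hl.insert hp' (hab.trans ((List.sublist_cons_self m s₄).append_left s₃)) hC

/-- Two neighbouring labels which are not separated by a code may be swapped. -/
theorem thresholdCodes_swap {m : ℕ} : ∀ {l₁ l₂ : List ℕ} {a b : ℕ} {p : List (Finset ℕ)},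
    LabelList m (l₁ ++ a :: b :: l₂) → p ∈ thresholdCodes m (l₁ ++ a :: b :: l₂) →
    (∀ C ∈ p, a ∈ C ↔ b ∈ C) → p ∈ thresholdCodes m (l₁ ++ b :: a :: l₂) := by
  induction m with
  | zero => intro l₁ l₂ a b p _ hp _; exact hp
  | succ m ih =>
    intro l₁ l₂ a b p hl hp hab
    obtain ⟨s₁, s₂, s₃, s₄, p', h₁, h₂, hp', rfl⟩ := mem_thresholdCodes_succ.1 hp
    have hab' : ∀ C ∈ p', a ∈ C ↔ b ∈ C := fun C hC => hab C (List.mem_cons_of_mem _ hC)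
    have hfirst : ∃ t₁ t₂, l₁ ++ b :: a :: l₂ = t₁ ++ t₂ ∧ s₁.toFinset = t₁.toFinset := by
      rcases List.append_cons_cons_eq_append h₁ with ⟨t, rfl, rfl⟩ | ⟨rfl, rfl⟩ | ⟨t, rfl, rfl⟩
      · exact ⟨s₁, t ++ b :: a :: l₂, by simp, rfl⟩
      · exfalso
        have h := (hab _ List.mem_cons_self).1 (by simp)
        have hn := hl.1
        simp only [List.mem_toFinset, List.mem_append, List.mem_singleton] at h
        simp only [List.nodup_append, List.nodup_cons, List.mem_cons] at hn
        rcases h with h | rfl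
        · exact hn.2.2 b h b (by simp) rfl
        · simp at hn
      · exact ⟨l₁ ++ b :: a :: t, s₂, by simp,
          List.toFinset_eq_of_perm _ _ ((List.Perm.swap b a t).append_left l₁)⟩
    have hsecond : ∃ t₃ t₄, l₁ ++ b :: a :: l₂ = t₃ ++ t₄ ∧
        p' ∈ thresholdCodes m (t₃ ++ m :: t₄) := by
      rw [h₂] at hl
      have hl' := hl.insert
      rcases List.append_cons_cons_eq_append h₂ with ⟨t, rfl, rfl⟩ | ⟨rfl, rfl⟩ | ⟨t, rfl, rfl⟩
      · refine ⟨s₃, t ++ b :: a :: l₂, by simp, ?_⟩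
        have := ih (l₁ := s₃ ++ m :: t) (l₂ := l₂) (a := a) (b := b) (p := p')
          (by simpa using hl') (by simpa using hp') hab'
        simpa using this
      · refine ⟨l₁ ++ [b], a :: l₂, by simp, ?_⟩
        simp only [List.append_assoc, List.cons_append, List.nil_append] at hl' hp' ⊢
        have ham : ∀ C ∈ p', a ∈ C ↔ m ∈ C := by
          intro C hC
          constructor
          · intro ha
            refine mem_of_sublist_of_mem_thresholdCodes hl' hp' (b := b) ?_ hC ((hab' C hC).1 ha)
            exact List.sublist_append_of_sublist_right (by simp)
          · refine mem_of_sublist_of_mem_thresholdCodes hl' hp' ?_ hC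
            exact List.sublist_append_of_sublist_right (by simp)
        have hp₁ := ih hl' hp' ham
        have hl₁ : LabelList m (l₁ ++ m :: a :: b :: l₂) :=
          hl'.perm ((List.Perm.swap m a _).append_left l₁)
        have hp₂ := ih (l₁ := l₁ ++ [m]) (by simpa using hl₁) (by simpa using hp₁) hab'
        have hl₂ : LabelList m (l₁ ++ m :: b :: a :: l₂) :=
          hl₁.perm (((List.Perm.swap b a l₂).cons m).append_left l₁)
        exact ih hl₂ (by simpa using hp₂) fun C hC => (ham C hC).symm.trans (hab' C hC)
      · refine ⟨l₁ ++ b :: a :: t, s₄, by simp, ?_⟩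
        have := ih (l₁ := l₁) (l₂ := t ++ m :: s₄) (a := a) (b := b) (p := p')
          (by simpa using hl') (by simpa using hp') hab'
        simpa using this
    obtain ⟨t₁, t₂, e₁, e⟩ := hfirst
    obtain ⟨t₃, t₄, e₂, hp''⟩ := hsecond
    exact mem_thresholdCodes_succ.2 ⟨t₁, t₂, t₃, t₄, p', e₁, e₂, hp'', by rw [e]⟩

theorem map_erase_mem_thresholdCodes {m : ℕ} : ∀ {l₁ l₂ : List ℕ} {b : ℕ} {p : List (Finset ℕ)},
    LabelList m (l₁ ++ b :: l₂) → p ∈ thresholdCodes m (l₁ ++ b :: l₂) →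
    p.map (fun C => C.erase b) ∈ thresholdCodes m (l₁ ++ l₂) := by
  induction m with
  | zero =>
    intro l₁ l₂ b p _ hp
    simp only [thresholdCodes, Finset.mem_singleton] at hp ⊢
    simp [hp]
  | succ m ih =>
    intro l₁ l₂ b p hl hp
    obtain ⟨s₁, s₂, s₃, s₄, p', h₁, h₂, hp', rfl⟩ := mem_thresholdCodes_succ.1 hp
    have hb : b ∉ l₁ ++ l₂ := (List.nodup_middle.1 hl.1 |> List.nodup_cons.1).1
    have hfirst : ∃ t₁ t₂, l₁ ++ l₂ = t₁ ++ t₂ ∧ s₁.toFinset.erase b = t₁.toFinset := by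
      rcases List.append_cons_eq_append h₁ with ⟨t, rfl, rfl⟩ | ⟨t, rfl, rfl⟩
      · refine ⟨s₁, t ++ l₂, by simp, Finset.erase_eq_of_notMem ?_⟩
        simp only [List.mem_append, List.mem_toFinset] at hb ⊢
        tauto
      · refine ⟨l₁ ++ t, s₂, by simp, ?_⟩
        ext c
        simp only [List.mem_append, List.mem_toFinset, Finset.mem_erase, List.mem_cons] at hb ⊢
        by_cases hc : c = b
        · subst hc; tauto
        · tauto
    have hsecond : ∃ t₃ t₄, l₁ ++ l₂ = t₃ ++ t₄ ∧
        p'.map (fun C => C.erase b) ∈ thresholdCodes m (t₃ ++ m :: t₄) := by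
      rw [h₂] at hl
      have hl' := hl.insert
      rcases List.append_cons_eq_append h₂ with ⟨t, rfl, rfl⟩ | ⟨t, rfl, rfl⟩
      · refine ⟨s₃, t ++ l₂, by simp, ?_⟩
        have := ih (l₁ := s₃ ++ m :: t) (l₂ := l₂) (b := b) (p := p')
          (by simpa using hl') (by simpa using hp')
        simpa using this
      · refine ⟨l₁ ++ t, s₄, by simp, ?_⟩
        have := ih (l₁ := l₁) (l₂ := t ++ m :: s₄) (b := b) (p := p')
          (by simpa using hl') (by simpa using hp')
        simpa using this
    obtain ⟨t₁, t₂, e₁, e⟩ := hfirst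
    obtain ⟨t₃, t₄, e₂, hp''⟩ := hsecond
    exact mem_thresholdCodes_succ.2 ⟨t₁, t₂, t₃, t₄, _, e₁, e₂, hp'', by rw [List.map_cons, e]⟩

theorem map_insert_mem_thresholdCodes {m : ℕ} :
    ∀ {l₁ l₂ : List ℕ} {a b : ℕ} {p : List (Finset ℕ)},
    LabelList m (l₁ ++ a :: b :: l₂) → p ∈ thresholdCodes m (l₁ ++ a :: l₂) →
    p.map (fun C => if a ∈ C then insert b C else C) ∈
      thresholdCodes m (l₁ ++ a :: b :: l₂) := by
  induction m with
  | zero =>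
    intro l₁ l₂ a b p _ hp
    simp only [thresholdCodes, Finset.mem_singleton] at hp ⊢
    simp [hp]
  | succ m ih =>
    intro l₁ l₂ a b p hl hp
    obtain ⟨s₁, s₂, s₃, s₄, p', h₁, h₂, hp', rfl⟩ := mem_thresholdCodes_succ.1 hp
    have ha : a ∉ l₁ ++ b :: l₂ := (List.nodup_middle.1 hl.1 |> List.nodup_cons.1).1
    have hfirst : ∃ t₁ t₂, l₁ ++ a :: b :: l₂ = t₁ ++ t₂ ∧
        (if a ∈ s₁.toFinset then insert b s₁.toFinset else s₁.toFinset) = t₁.toFinset := by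
      rcases List.append_cons_eq_append h₁ with ⟨t, rfl, rfl⟩ | ⟨t, rfl, rfl⟩
      · refine ⟨s₁, t ++ a :: b :: l₂, by simp, if_neg ?_⟩
        simp only [List.mem_append, List.mem_toFinset] at ha ⊢
        tauto
      · refine ⟨l₁ ++ a :: b :: t, s₂, by simp, ?_⟩
        rw [if_pos (by simp)]
        ext c
        simp only [List.mem_append, List.mem_toFinset, Finset.mem_insert, List.mem_cons]
        tauto
    have hsecond : ∃ t₃ t₄, l₁ ++ a :: b :: l₂ = t₃ ++ t₄ ∧
        p'.map (fun C => if a ∈ C then insert b C else C) ∈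
          thresholdCodes m (t₃ ++ m :: t₄) := by
      rcases List.append_cons_eq_append h₂ with ⟨t, rfl, rfl⟩ | ⟨t, rfl, rfl⟩
      · refine ⟨s₃, t ++ a :: b :: l₂, by simp, ?_⟩
        have hl' := LabelList.insert (l₁ := s₃) (l₂ := t ++ a :: b :: l₂) (by simpa using hl)
        have := ih (l₁ := s₃ ++ m :: t) (l₂ := l₂) (a := a) (b := b) (p := p')
          (by simpa using hl') (by simpa using hp')
        simpa using this
      · refine ⟨l₁ ++ a :: b :: t, s₄, by simp, ?_⟩
        have hl' := LabelList.insert (l₁ := l₁ ++ a :: b :: t) (l₂ := s₄) (by simpa using hl)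
        have := ih (l₁ := l₁) (l₂ := t ++ m :: s₄) (a := a) (b := b) (p := p')
          (by simpa using hl') (by simpa using hp')
        simpa using this
    obtain ⟨t₁, t₂, e₁, e⟩ := hfirst
    obtain ⟨t₃, t₄, e₂, hp''⟩ := hsecond
    exact mem_thresholdCodes_succ.2 ⟨t₁, t₂, t₃, t₄, _, e₁, e₂, hp'', by rw [List.map_cons, e]⟩

/-- The codes which do not separate two neighbouring labels correspond to the codes of the list
without the second label. -/
theorem card_filter_thresholdCodes {m : ℕ} {l₁ l₂ : List ℕ} {a b : ℕ}
    (hl : LabelList m (l₁ ++ a :: b :: l₂)) :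
    ((thresholdCodes m (l₁ ++ a :: b :: l₂)).filter fun p => ∀ C ∈ p, a ∈ C ↔ b ∈ C).card
      = (thresholdCodes m (l₁ ++ a :: l₂)).card := by
  have hl' : LabelList m ((l₁ ++ [a]) ++ b :: l₂) := by simpa using hl
  have hb : b ∉ (l₁ ++ [a]) ++ l₂ := (List.nodup_middle.1 hl'.1 |> List.nodup_cons.1).1
  have hne : a ≠ b := by rintro rfl; simp at hb
  have hmb : m ≤ b := hl.2 b (by simp)
  have hbC : ∀ p ∈ thresholdCodes m (l₁ ++ a :: l₂), ∀ C ∈ p, b ∉ C := by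
    intro p hp C hC h
    rcases mem_or_lt_of_mem_thresholdCodes hp hC h with h | h
    · exact hb (by simpa using h)
    · omega
  refine Finset.card_nbij' (fun p => p.map fun C => C.erase b)
    (fun p => p.map fun C => if a ∈ C then insert b C else C) ?_ ?_ ?_ ?_
  · intro p hp
    have hp := (Finset.mem_filter.1 hp).1
    simpa using map_erase_mem_thresholdCodes hl' (by simpa using hp)
  · intro p hp
    refine Finset.mem_coe.2 (Finset.mem_filter.2 ⟨map_insert_mem_thresholdCodes hl hp, ?_⟩)
    intro C hC
    obtain ⟨C, hCp, rfl⟩ := List.mem_map.1 hC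
    have := hbC p hp C hCp
    split_ifs with h <;> simp [h, this]
  · intro p hp
    have hp := (Finset.mem_filter.1 hp).2
    simp only [List.map_map]
    refine (List.map_congr_left fun C hC => ?_).trans (List.map_id p)
    have h := hp C hC
    by_cases ha : a ∈ C
    · simp [ha, hne, Finset.insert_erase (h.1 ha)]
    · simp [ha, Finset.erase_eq_of_notMem (mt h.2 ha)]
  · intro p hp
    simp only [List.map_map]
    refine (List.map_congr_left fun C hC => ?_).trans (List.map_id p)
    have h := hbC p hp C hC
    by_cases ha : a ∈ C
    · simp [ha, h]
    · simp [ha, h]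

theorem card_image_take_toFinset {l : List ℕ} (hl : l.Nodup) :
    ((Finset.range (l.length + 1)).image fun i => (l.take i).toFinset).card = l.length + 1 := by
  rw [Finset.card_image_of_injOn, Finset.card_range]
  intro i hi j hj h
  have h' := congrArg Finset.card h
  simp only [Finset.coe_range, Set.mem_Iio] at hi hj
  rw [List.toFinset_card_of_nodup (hl.sublist (List.take_sublist i l)),
    List.toFinset_card_of_nodup (hl.sublist (List.take_sublist j l)),
    List.length_take, List.length_take] at h'
  omega

theorem card_thresholdCodes {m : ℕ} : ∀ {l : List ℕ}, LabelList m l →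
    ((thresholdCodes m l).card : ℤ) = gandhiValue m l.length := by
  induction m with
  | zero => intro l _; simp [thresholdCodes, gandhiValue]
  | succ m ih =>
    intro l hl
    set P := fun g => thresholdCodes m (l.take g ++ m :: l.drop g) with hP
    have hins : ∀ g, LabelList m (l.take g ++ m :: l.drop g) := fun g =>
      LabelList.insert (by rwa [List.take_append_drop])
    have hPc : ∀ g, ((P g).card : ℤ) = gandhiValue m (l.length + 1) := by
      intro g
      rw [ih (hins g)]
      congr 1
      rw [List.length_append, List.length_cons, List.length_take, List.length_drop]
      omega
    have hU : ∀ g ≤ l.length, (((Finset.range (g + 1)).biUnion P).card : ℤ)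
        = (g + 1) * gandhiValue m (l.length + 1) - g * gandhiValue m l.length := by
      intro g hg
      induction g with
      | zero => simp [hPc]
      | succ g ihg =>
        have hgl : g < l.length := hg
        obtain ⟨a, ha⟩ : ∃ a, a = l[g] := ⟨_, rfl⟩
        have hdrop : l.drop g = a :: l.drop (g + 1) := by
          rw [ha]; exact List.drop_eq_getElem_cons hgl
        have htake : l.take (g + 1) = l.take g ++ [a] := by
          rw [ha]; exact List.take_succ_eq_append_getElem hgl
        have hl₀ := hins (g + 1)
        rw [htake, List.append_assoc, List.singleton_append] at hl₀
        have hP₁ : P (g + 1) = thresholdCodes m (l.take g ++ a :: m :: l.drop (g + 1)) := by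
          rw [hP]; simp only []; rw [htake, List.append_assoc, List.singleton_append]
        have hP₀ : P g = thresholdCodes m (l.take g ++ m :: a :: l.drop (g + 1)) := by
          rw [hP]; simp only []; rw [hdrop]
        have hinter : (Finset.range (g + 1)).biUnion P ∩ P (g + 1)
            = (P (g + 1)).filter fun p => ∀ C ∈ p, a ∈ C ↔ m ∈ C := by
          ext p
          simp only [Finset.mem_inter, Finset.mem_biUnion, Finset.mem_range, Finset.mem_filter]
          constructor
          · rintro ⟨⟨g', hg', hp'⟩, hp⟩
            refine ⟨hp, fun C hC => ⟨fun h => ?_, fun h => ?_⟩⟩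
            · refine mem_of_sublist_of_mem_thresholdCodes (hins g') hp' ?_ hC h
              refine List.sublist_append_of_sublist_right (List.Sublist.cons_cons m ?_)
              rw [List.singleton_sublist]
              have : a ∈ l.drop g := by rw [hdrop]; simp
              exact List.drop_subset_drop_left l (Nat.lt_succ_iff.1 hg') this
            · rw [hP₁] at hp
              refine mem_of_sublist_of_mem_thresholdCodes hl₀ hp ?_ hC h
              exact List.sublist_append_of_sublist_right (by simp)
          · rintro ⟨hp, hC⟩
            refine ⟨⟨g, Nat.lt_succ_self g, ?_⟩, hp⟩
            rw [hP₁] at hp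
            rw [hP₀]
            exact thresholdCodes_swap hl₀ hp hC
        have hcontr : (((P (g + 1)).filter fun p => ∀ C ∈ p, a ∈ C ↔ m ∈ C).card : ℤ)
            = gandhiValue m l.length := by
          rw [hP₁, card_filter_thresholdCodes hl₀, ih (hl₀.sublist
            (((List.sublist_cons_self m _).cons_cons a).append_left _)), ← hdrop,
            List.take_append_drop]
        have hcard := Finset.card_union_add_card_inter ((Finset.range (g + 1)).biUnion P) (P (g + 1))
        rw [hinter] at hcard
        rw [Finset.range_add_one, Finset.biUnion_insert, Finset.union_comm]
        have hcard' := congrArg (Nat.cast : ℕ → ℤ) hcard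
        push_cast at hcard' ⊢
        rw [hcontr, hPc, ihg (by omega)] at hcard'
        linarith
    rw [thresholdCodes, Finset.card_image_of_injective, Finset.card_product,
      card_image_take_toFinset hl.1, gandhiValue, Nat.cast_mul, hU _ le_rfl]
    · push_cast; ring
    · rintro ⟨C, p⟩ ⟨C', p'⟩ h
      simpa using h

/-- The code of real label values `V` and real thresholds `W`. -/
noncomputable def realCode (V W : ℕ → ℝ) : ℕ → Finset ℕ → List (Finset ℕ)
  | 0, _ => []
  | m + 1, T => (T.filter fun c => V c < W m) :: realCode V W m (insert m T)

theorem List.exists_append_of_pairwise_le {V : ℕ → ℝ} {l : List ℕ}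
    (h : l.Pairwise fun c d => V c ≤ V d) (w : ℝ) :
    ∃ s₁ s₂, l = s₁ ++ s₂ ∧ (∀ c ∈ s₁, V c < w) ∧ ∀ c ∈ s₂, w ≤ V c := by
  induction l with
  | nil => exact ⟨[], [], by simp⟩
  | cons x l ih =>
    rw [List.pairwise_cons] at h
    rcases lt_or_ge (V x) w with hx | hx
    · obtain ⟨s₁, s₂, rfl, h₁, h₂⟩ := ih h.2
      exact ⟨x :: s₁, s₂, rfl, by simpa [hx] using h₁, h₂⟩
    · refine ⟨[], x :: l, rfl, by simp, ?_⟩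
      simpa [hx] using fun c hc => hx.trans (h.1 c hc)

theorem realCode_mem_thresholdCodes (V W : ℕ → ℝ) (m : ℕ) : ∀ l : List ℕ,
    l.Pairwise (fun c d => V c ≤ V d) → realCode V W m l.toFinset ∈ thresholdCodes m l := by
  induction m with
  | zero => intro l _; simp [realCode, thresholdCodes]
  | succ m ih =>
    intro l hl
    obtain ⟨s₁, s₂, h₁, hs₁, hs₂⟩ := List.exists_append_of_pairwise_le hl (W m)
    obtain ⟨s₃, s₄, h₂, hs₃, hs₄⟩ := List.exists_append_of_pairwise_le hl (V m)
    refine mem_thresholdCodes_succ.2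
      ⟨s₁, s₂, s₃, s₄, realCode V W m (insert m l.toFinset), h₁, h₂, ?_, ?_⟩
    · have hins : insert m l.toFinset = (s₃ ++ m :: s₄).toFinset := by
        rw [h₂]; ext c; simp
      rw [hins]
      apply ih
      rw [h₂, List.pairwise_append] at hl
      rw [List.pairwise_append, List.pairwise_cons]
      refine ⟨hl.1, ⟨hs₄, hl.2.1⟩, fun c hc d hd => ?_⟩
      rcases List.mem_cons.1 hd with rfl | hd
      · exact (hs₃ c hc).le
      · exact hl.2.2 c hc d hd
    · rw [realCode]
      congr 1
      ext c
      simp only [Finset.mem_filter, List.mem_toFinset, h₁, List.mem_append]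
      constructor
      · rintro ⟨hc | hc, h⟩
        · exact hc
        · exact absurd h (hs₂ c hc).not_gt
      · exact fun hc => ⟨Or.inl hc, hs₁ c hc⟩

theorem lt_iff_lt_of_realCode_eq {V W V' W' : ℕ → ℝ} {m : ℕ} : ∀ {T : Finset ℕ},
    realCode V W m T = realCode V' W' m T → ∀ c j, j < m → (c ∈ T ∨ j < c ∧ c < m) →
    (V c < W j ↔ V' c < W' j) := by
  induction m with
  | zero => intro T _ c j hj; omega
  | succ m ih =>
    intro T h c j hj hc
    rw [realCode, realCode, List.cons.injEq] at h
    rcases Nat.lt_succ_iff_lt_or_eq.1 hj with hj | rfl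
    · refine ih h.2 c j hj ?_
      rcases hc with hc | ⟨h₁, h₂⟩
      · exact Or.inl (Finset.mem_insert_of_mem hc)
      · rcases Nat.lt_succ_iff_lt_or_eq.1 h₂ with h₂ | rfl
        · exact Or.inr ⟨h₁, h₂⟩
        · exact Or.inl (Finset.mem_insert_self _ _)
    · have hc : c ∈ T := by
        rcases hc with hc | hc
        · exact hc
        · omega
      have := Finset.ext_iff.1 h.1 c
      simpa [hc] using this

theorem notMem_sUnion_generalizedLinialArrangement {n : ℕ} {a : Fin n → ℝ} {x : sumZeroSpace n} :
    x ∈ (⋃₀ generalizedLinialArrangement a)ᶜ ↔ ∀ i j, i < j → x.1 i - x.1 j ≠ a i := by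
  simp only [generalizedLinialArrangement, Set.mem_compl_iff, Set.mem_sUnion, not_exists, not_and]
  constructor
  · intro h i j hij hx
    exact h _ ⟨i, j, hij, rfl⟩ hx
  · rintro h _ ⟨i, j, hij, rfl⟩ hx
    exact h i j hij hx

theorem connectedComponentIn_eq_of_same_side {n : ℕ} {a : Fin n → ℝ} {x y : sumZeroSpace n}
    (hx : x ∈ (⋃₀ generalizedLinialArrangement a)ᶜ) (hy : y ∈ (⋃₀ generalizedLinialArrangement a)ᶜ)
    (h : ∀ i j, i < j → (x.1 i - x.1 j < a i ↔ y.1 i - y.1 j < a i)) :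
    connectedComponentIn (⋃₀ generalizedLinialArrangement a)ᶜ x
      = connectedComponentIn (⋃₀ generalizedLinialArrangement a)ᶜ y := by
  refine connectedComponentIn_eq ?_
  refine (convex_segment x y).isPreconnected.subset_connectedComponentIn
    (left_mem_segment ℝ x y) ?_ (right_mem_segment ℝ x y)
  rintro z ⟨s, t, hs, ht, hst, rfl⟩
  rw [notMem_sUnion_generalizedLinialArrangement] at hx hy ⊢
  intro i j hij
  have hx := hx i j hij
  have hy := hy i j hij
  have h := h i j hij
  have hz : (s • x + t • y).1 i - (s • x + t • y).1 j - a i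
      = s * (x.1 i - x.1 j - a i) + t * (y.1 i - y.1 j - a i) := by
    simp only [Submodule.coe_add, Submodule.coe_smul, PiLp.add_apply, PiLp.smul_apply, smul_eq_mul]
    linear_combination a i * hst
  intro h0
  rw [h0, sub_self] at hz
  rcases lt_or_gt_of_ne hx with hx | hx
  · have hy := h.1 hx
    rcases hs.eq_or_lt with rfl | hs
    · nlinarith
    · nlinarith [mul_neg_of_pos_of_neg hs (sub_neg.2 hx),
        mul_nonpos_of_nonneg_of_nonpos ht (sub_neg.2 hy).le]
  · have hy : a i < y.1 i - y.1 j := lt_of_le_of_ne (not_lt.1 (mt h.2 hx.not_gt)) hy.symm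
    rcases hs.eq_or_lt with rfl | hs
    · nlinarith
    · nlinarith [mul_pos hs (sub_pos.2 hx), mul_nonneg ht (sub_pos.2 hy).le]

/-- The code of a point, in which the label `n - 1 - i` stands for the value `x i - a i`. -/
noncomputable def pointCode {n : ℕ} (a : Fin n → ℝ) (x : sumZeroSpace n) : List (Finset ℕ) :=
  realCode (fun c => if h : n - 1 - c < n then x.1 ⟨n - 1 - c, h⟩ - a ⟨n - 1 - c, h⟩ else 0)
    (fun c => if h : n - 1 - c < n then x.1 ⟨n - 1 - c, h⟩ else 0) (n - 1) {n - 1}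

theorem same_side_of_pointCode_eq {n : ℕ} {a : Fin n → ℝ} {x y : sumZeroSpace n}
    (h : pointCode a x = pointCode a y) (i j : Fin n) (hij : i < j) :
    x.1 i - x.1 j < a i ↔ y.1 i - y.1 j < a i := by
  have hij' : (i : ℕ) < j := hij
  have hj := j.2
  have key := lt_iff_lt_of_realCode_eq h (n - 1 - i) (n - 1 - j) (by omega) (by simp; omega)
  have ei : n - 1 - (n - 1 - (i : ℕ)) = i := by omega
  have ej : n - 1 - (n - 1 - (j : ℕ)) = j := by omega
  simp only [ei, ej, i.2, j.2, dif_pos, Fin.eta] at key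
  rw [sub_lt_comm, key, sub_lt_comm]

theorem mainTheorem12 (n : ℕ) (hn : 1 ≤ n) (a : Fin n → ℝ) (ha : ∀ i, 0 ≤ a i) :
    (arrangementRegions (generalizedLinialArrangement a)).encard ≤ (medianGenocchi n : ℕ∞) := by
  have hcard : (thresholdCodes (n - 1) [n - 1]).card = medianGenocchi n := by
    have h := card_thresholdCodes (m := n - 1) (l := [n - 1])
      ⟨by simp, fun c hc => (List.mem_singleton.1 hc).ge⟩
    rw [List.length_singleton, gandhiValue_one, Nat.sub_add_cancel hn] at h
    exact_mod_cast h
  have hR : ∀ R ∈ arrangementRegions (generalizedLinialArrangement a),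
      ∃ x, x ∈ (⋃₀ generalizedLinialArrangement a)ᶜ ∧
        R = connectedComponentIn (⋃₀ generalizedLinialArrangement a)ᶜ x := fun R h => h
  choose! x hx hRx using hR
  rw [← hcard, ← Set.encard_coe_eq_coe_finsetCard]
  refine Set.encard_le_encard_of_injOn (f := fun R => pointCode a (x R)) ?_ ?_
  · intro R _
    exact realCode_mem_thresholdCodes _ _ (n - 1) [n - 1] (by simp)
  · intro R hR R' hR' h
    rw [hRx R hR, hRx R' hR']
    exact connectedComponentIn_eq_of_same_side (hx R hR) (hx R' hR')
      (same_side_of_pointCode_eq h)
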